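/- A *near-ring* $(N,+,*)$ is a (not necessarily abelian) group $(N,+)$ with an associative multiplication $*$ satisfying the right distributive law $(a+b)*c=a*c+b*c$; it is *zero symmetric* if $0*n=n*0=0$ for all $n$. Let $U$ be the set of units (two-sided multiplicatively invertible elements) of a near-ring with identity and let $U_0=U\cup\{0\}$. A *near-field* is a near-ring whose nonzero elements form a group under $*$, the identity of which is the identity of the near-ring. An *f-near-ring* is a zero symmetric near-ring with identity such that every right translation $n\mapsto n*u$ with $u\in U$ that is not the identity map has $0$ as its only fixed point. An *a-near-ring* is a zero symmetric near-ring with identity such that $U_0$, with the restricted operations, is a subnear-field. **Theorem.** Let $p$ be a prime and let $(N,+,*)$ be an f-near-ring of order $p^2$ which is not a near-field. Then $N$ is also an a-near-ring, and $(U_0,+,*)$ is a field. If moreover $N$ is not a ring, then there is a map $\alpha:U_0\to U_0$ with $\alpha(0)=0$ that restricts to an automorphism of the multiplicative group $(U,*)$, such that $(N,+,*)$ is isomorphic to the near-ring $(V,+,*_1)$, where $(V,+)=(U_0\times U_0,+)$ with componentwise addition and $$(x_1,x_2)*_1(0,a_2)=(x_1*\alpha(a_2),\,x_2*a_2),\qquad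 (x_1,x_2)*_1(a_1,a_2)=(x_2*a_1,\,x_2*a_2)\ \text{ if } a_1\neq 0 .$$ -/

import Mathlib

/-- A (right) near-ring: a group `(N, +)`, not assumed to be abelian, with an associative
multiplication satisfying the right distributive law. -/
class NearRing (N : Type*) extends AddGroup N, Semigroup N where
  right_distrib' : ∀ a b c : N, (a + b) * c = a * c + b * c

/-- A near-ring with a two-sided multiplicative identity `1`. -/
class NearRingWithOne (N : Type*) extends NearRing N, Monoid N

namespace NearRing

/-- `0 * n = n * 0 = 0` for all `n`. -/
def IsZeroSymmetric (N : Type*) [NearRing N] : Prop :=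
  ∀ n : N, 0 * n = 0 ∧ n * 0 = 0

/-- The near-ring is a ring: the addition is commutative and the left distributive law holds. -/
def IsRing (N : Type*) [NearRing N] : Prop :=
  (∀ a b : N, a + b = b + a) ∧ ∀ a b c : N, a * (b + c) = a * b + a * c

/-- A near-field: there is an identity `e ≠ 0`, and every nonzero element has a two-sided
inverse. -/
def IsNearField (N : Type*) [NearRing N] : Prop :=
  ∃ e : N, e ≠ 0 ∧ (∀ a : N, e * a = a ∧ a * e = a) ∧ ∀ a : N, a ≠ 0 → ∃ b : N, a * b = e ∧ b * a = e

/-- The near-ring is a (commutative) field. -/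
def IsCommField (N : Type*) [NearRing N] : Prop :=
  IsNearField N ∧ IsRing N ∧ ∀ a b : N, a * b = b * a

/-- The right translation `n ↦ n * u`, an endomorphism of `(N, +)`. -/
def rightTranslation {N : Type*} [NearRing N] (u : N) : N →+ N :=
  AddMonoidHom.mk' (fun n => n * u) (fun a b => right_distrib' a b u)

/-- `0` is the only fixed point of `φ`. -/
def IsFixedPointFree {N : Type*} [NearRing N] (φ : N →+ N) : Prop :=
  ∀ n : N, φ n = n → n = 0

/-- An f-near-ring: zero symmetric, with identity, and such that every right translation by a unit
that is not the identity map is fixed point free. -/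
def IsFNearRing (N : Type*) [NearRingWithOne N] : Prop :=
  IsZeroSymmetric N ∧
    ∀ u : Nˣ, rightTranslation (u : N) ≠ AddMonoidHom.id N →
      IsFixedPointFree (rightTranslation (u : N))

/-- A subnear-ring: an additive subgroup that is closed under multiplication. -/
structure SubNearRing (N : Type*) [NearRing N] extends AddSubgroup N where
  mul_mem' : ∀ {a b : N}, a ∈ carrier → b ∈ carrier → a * b ∈ carrier

/-- The elements of a subnear-ring, as a type. -/
abbrev SubNearRing.Elem {N : Type*} [NearRing N] (S : SubNearRing N) : Type _ :=
  S.toAddSubgroup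

/-- A subnear-ring is a near-ring with the operations restricted from `N`. -/
instance SubNearRing.instNearRing {N : Type*} [NearRing N] (S : SubNearRing N) :
    NearRing S.Elem where
  toAddGroup := inferInstance
  mul a b := ⟨a.1 * b.1, S.mul_mem' a.2 b.2⟩
  mul_assoc a b c := Subtype.ext (mul_assoc a.1 b.1 c.1)
  right_distrib' a b c := Subtype.ext (right_distrib' a.1 b.1 c.1)

/-- The set `U₀` of all units, together with `0`. -/
def unitsWithZero (N : Type*) [NearRingWithOne N] : Set N :=
  {n : N | IsUnit n ∨ n = 0}

/-- An a-near-ring: zero symmetric, with identity, and such that the units together with `0` form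
a subnear-field. -/
def IsANearRing (N : Type*) [NearRingWithOne N] : Prop :=
  IsZeroSymmetric N ∧
    ∃ S : SubNearRing N, S.carrier = unitsWithZero N ∧ IsNearField S.Elem

/-- `α 0 = 0` and `α` restricts to an automorphism of the multiplicative group of nonzero
elements (of a near-field `F`). -/
def IsZeroPreservingMulAut {F : Type*} [NearRing F] (α : F → F) : Prop :=
  α 0 = 0 ∧ Set.BijOn α {a | a ≠ 0} {a | a ≠ 0} ∧
    ∀ a b : F, a ≠ 0 → b ≠ 0 → α (a * b) = α a * α b

/-- The set `F ^ k` with `k = m + 1`, which carries componentwise addition and the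
multiplication twisted by the maps `α i`, defined below. -/
def TwistedPower (F : Type*) (m : ℕ) (_α : Fin (m + 1) → F → F) : Type _ :=
  Fin (m + 1) → F

namespace TwistedPower

variable {F : Type*} [NearRing F] {m : ℕ} {α : Fin (m + 1) → F → F}

instance : AddGroup (TwistedPower F m α) :=
  inferInstanceAs (AddGroup (Fin (m + 1) → F))

open Classical in
/-- If all coordinates of `a` but the last one vanish, then
`x * a = (x₁ * α₁ (a_k), …, x_k * α_k (a_k))`; otherwise `x * a = (x_k * a₁, …, x_k * a_k)`.
(In the construction `α_k` is the identity map.) -/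
noncomputable instance : Mul (TwistedPower F m α) where
  mul x a :=
    if ∀ i : Fin (m + 1), i ≠ Fin.last m → a i = 0 then
      fun i => x i * α i (a (Fin.last m))
    else
      fun i => x (Fin.last m) * a i

end TwistedPower

end NearRing

/-! A group of order `p ^ 2` is abelian. Fixed-point-freeness forces characteristic `p`, because `z
= p • 1` is fixed by right translation by the unit `1 + z`. So `N` is a plane over `ZMod p` on which
right translations are linear.

As `N` is not a near-field, some nonzero `w` is not a unit, and `R w` has image the line of `w`.
Every unit moves `w` along this line. Dividing a unit by the scalar gives a unit `v` with `v * w =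
w`, so `R w` kills `R v - id`. Hence `R v` has a nonzero fixed point and `v = 1`. The units are thus
the nonzero multiples of `1` (`exists_eq_smul_one`), and `U₀` is a copy of `ZMod p`.

If `N` is not a ring, one more vector `e` is needed: independent of `1`, an eigenvector of all
scalar translations, and killed by all others (`exists_isComplementVector`). In the basis `e, 1` the
product is the twisted one, with `α` the eigenvalue of `e`. -/

open Module

namespace NearRing

/-- The right translations of a zero symmetric near-ring with identity whose additive group is a
vector space on which all right translations are linear; `R b a` is the product `a * b`. -/
structure LinearTranslations (F V : Type*) [Field F] [AddCommGroup V] [Module F V] where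
  R : V → V →ₗ[F] V
  one : V
  map_zero : R 0 = 0
  map_one : R one = LinearMap.id
  apply_one : ∀ b, R b one = b
  map_apply : ∀ a b, R (R b a) = R b ∘ₗ R a

theorem exists_basis_pair {F V : Type*} [Field F] [AddCommGroup V] [Module F V]
    (hV : finrank F V = 2) {e f : V} (hf : f ≠ 0) (he : ∀ k : F, e ≠ k • f) :
    ∃ B : Basis (Fin 2) F V, B 0 = e ∧ B 1 = f := by
  have hli : LinearIndependent F ![e, f] := by
    rw [LinearIndependent.pair_symm_iff, LinearIndependent.pair_iff' hf]
    exact fun k => (he k).symm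
  refine ⟨basisOfLinearIndependentOfCardEqFinrank hli (by simp [hV]), ?_, ?_⟩ <;> simp

theorem exists_eq_smul_add_smul {F V : Type*} [Field F] [AddCommGroup V] [Module F V]
    (hV : finrank F V = 2) {e f : V} (hf : f ≠ 0) (he : ∀ k : F, e ≠ k • f) (x : V) :
    ∃ a b : F, x = a • e + b • f := by
  obtain ⟨B, rfl, rfl⟩ := exists_basis_pair hV hf he
  exact ⟨B.repr x 0, B.repr x 1, by rw [← Fin.sum_univ_two (fun i => B.repr x i • B i), B.sum_repr]⟩

theorem smul_add_smul_eq_zero {F V : Type*} [Field F] [AddCommGroup V] [Module F V]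
    {e f : V} (hf : f ≠ 0) (he : ∀ k : F, e ≠ k • f) {a b : F} (h : a • e + b • f = 0) :
    a = 0 ∧ b = 0 := by
  have ha : a = 0 := by
    by_contra ha
    apply he (-(a⁻¹ * b))
    have h' : a • e = -(b • f) := eq_neg_of_add_eq_zero_left h
    rw [neg_smul, mul_smul, ← smul_neg, ← h', inv_smul_smul₀ ha]
  subst ha
  simpa [hf] using h

/-! ### Units are multiples of the identity -/

namespace LinearTranslations

variable {F V : Type*} [Field F] [AddCommGroup V] [Module F V] (T : LinearTranslations F V)

/-- Every invertible right translation with a nonzero fixed point is the identity. -/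
def FixedPointFree : Prop :=
  ∀ u, Function.Injective (T.R u) → ∀ x, x ≠ 0 → T.R u x = x → u = T.one

/-- The left distributive law. -/
def LeftDistrib : Prop := ∀ a b, T.R (a + b) = T.R a + T.R b

theorem R_smul (k : F) (b : V) : T.R (k • b) = T.R b ∘ₗ T.R (k • T.one) := by
  rw [← T.map_apply, map_smul, T.apply_one]

theorem R_smul_one_comp (k l : F) :
    T.R (k • T.one) ∘ₗ T.R (l • T.one) = T.R ((k * l) • T.one) := by
  rw [← T.map_apply, map_smul, T.apply_one, smul_smul, mul_comm]

theorem injective_R_smul_one {k : F} (hk : k ≠ 0) : Function.Injective (T.R (k • T.one)) := by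
  have h : T.R (k⁻¹ • T.one) ∘ₗ T.R (k • T.one) = LinearMap.id := by
    rw [R_smul_one_comp, inv_mul_cancel₀ hk, one_smul, T.map_one]
  exact Function.LeftInverse.injective (g := T.R (k⁻¹ • T.one)) fun x => DFunLike.congr_fun h x

theorem one_ne_zero {w : V} (hw : w ≠ 0) : T.one ≠ 0 := fun h => hw <| by
  rw [← T.apply_one w, h, _root_.map_zero]

/-- The range contains `w = 1 * w` and has dimension at most one. -/
theorem exists_apply_eq_smul (hV : finrank F V = 2) {w : V} (hw : w ≠ 0)
    (hinj : ¬ Function.Injective (T.R w)) (x : V) : ∃ k : F, T.R w x = k • w := by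
  have : FiniteDimensional F V := .of_finrank_pos (by omega)
  have hker : 0 < finrank F (LinearMap.ker (T.R w)) := by
    rw [finrank_pos_iff, Submodule.nontrivial_iff_ne_bot]
    exact fun h => hinj (LinearMap.ker_eq_bot.1 h)
  have hsum := LinearMap.finrank_range_add_finrank_ker (T.R w)
  have hle : Submodule.span F {w} ≤ LinearMap.range (T.R w) := by
    rw [Submodule.span_singleton_le_iff_mem]
    exact ⟨T.one, T.apply_one w⟩
  have heq := Submodule.eq_of_le_of_finrank_le hle (by rw [finrank_span_singleton hw]; omega)
  have hx : T.R w x ∈ Submodule.span F {w} := heq ▸ LinearMap.mem_range_self _ x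
  obtain ⟨k, hk⟩ := Submodule.mem_span_singleton.1 hx
  exact ⟨k, hk.symm⟩

theorem exists_eq_smul_one (hV : finrank F V = 2) (hT : T.FixedPointFree) {w : V} (hw : w ≠ 0)
    (hinj : ¬ Function.Injective (T.R w)) {u : V} (hu : Function.Injective (T.R u)) :
    ∃ k : F, u = k • T.one := by
  have : FiniteDimensional F V := .of_finrank_pos (by omega)
  obtain ⟨k, hk⟩ := T.exists_apply_eq_smul hV hw hinj u
  have hk0 : k ≠ 0 := by
    rintro rfl
    obtain ⟨v, hv⟩ := LinearMap.surjective_of_injective hu T.one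
    have h := DFunLike.congr_fun (T.map_apply u w) v
    rw [hk, zero_smul, T.map_zero, LinearMap.comp_apply, hv, T.apply_one] at h
    exact hw h.symm
  have hv : Function.Injective (T.R (k⁻¹ • u)) := by
    rw [R_smul]
    exact hu.comp (T.injective_R_smul_one (inv_ne_zero hk0))
  -- With `v = k⁻¹ • u`, `v * w = w` gives `R w ∘ R v = R w`.
  have hcomp : T.R w ∘ₗ (T.R (k⁻¹ • u) - (LinearMap.id : V →ₗ[F] V)) = 0 := by
    rw [LinearMap.comp_sub, ← T.map_apply, map_smul, hk, inv_smul_smul₀ hk0, LinearMap.comp_id,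
      sub_self]
  have hninj : ¬ Function.Injective (T.R (k⁻¹ • u) - (LinearMap.id : V →ₗ[F] V)) := by
    intro h
    obtain ⟨y, hy⟩ := LinearMap.surjective_of_injective h T.one
    have := DFunLike.congr_fun hcomp y
    rw [LinearMap.comp_apply, hy, T.apply_one] at this
    exact hw this
  rw [injective_iff_map_eq_zero] at hninj
  push Not at hninj
  obtain ⟨x, hx, hx0⟩ := hninj
  have := hT _ hv x hx0 (by simpa [sub_eq_zero] using hx)
  exact ⟨k, by rw [← this, smul_inv_smul₀ hk0]⟩

/-- The units of `T` are the nonzero scalar multiples of the identity. -/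
def UnitsAreScalars : Prop := ∀ u, Function.Injective (T.R u) → ∃ k : F, u = k • T.one

/-! ### Existence of the complement vector -/

variable {T}

theorem UnitsAreScalars.exists_functional (hU : T.UnitsAreScalars) (hV : finrank F V = 2) {w : V}
    (hw : ∀ k : F, w ≠ k • T.one) :
    ∃ l : V → F, l T.one = 1 ∧ ∀ x, T.R w x = l x • w := by
  have hw0 : w ≠ 0 := by simpa using hw 0
  choose l hl using T.exists_apply_eq_smul hV hw0 (fun h => let ⟨k, hk⟩ := hU w h; hw k hk)
  refine ⟨l, ?_, hl⟩
  have := hl T.one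
  rw [T.apply_one] at this
  exact smul_left_injective F hw0 (by simpa using this.symm)

theorem R_apply_eq_of_eq_smul {v w : V} {k : F} (hk : T.R w v = k • w) (x : V) :
    T.R w (T.R v x) = T.R w (T.R (k • T.one) x) := by
  rw [← LinearMap.comp_apply, ← LinearMap.comp_apply, ← T.map_apply, hk, R_smul]

/-- A second coordinate vector in which the multiplication takes its normal form. -/
def IsComplementVector (T : LinearTranslations F V) (e : V) : Prop :=
  (∀ k : F, e ≠ k • T.one) ∧ (∀ k : F, ∃ c : F, T.R (k • T.one) e = c • e) ∧
    ∀ a, (∀ k : F, a ≠ k • T.one) → T.R a e = 0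

/-- Evaluating `(x * w) * w'` in two ways gives `l x * l' w = l' w * l' x`. -/
theorem functional_eq_of_ne_zero (hs : ∀ (k : F) x, T.R (k • T.one) x = k • x) {w w' : V}
    (hw' : w' ≠ 0) {l l' : V → F} (hl : ∀ x, T.R w x = l x • w) (hl' : ∀ x, T.R w' x = l' x • w')
    (h : l' w ≠ 0) : l = l' := by
  funext x
  have := R_apply_eq_of_eq_smul (hl' w) x
  rw [hs, hl, map_smul, map_smul, hl', hl', smul_smul, smul_smul, mul_comm] at this
  exact mul_left_cancel₀ h (smul_left_injective F hw' this)

/-- With all nonscalars on two lines, each `w + k • w'` with `k ≠ 0` lies on the line of `1`. This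
determines `k`, so `F` has two elements and the product is that of `F × F`, a ring. -/
theorem leftDistrib_of_orthogonal (hV : finrank F V = 2) {w w' : V} (hw0 : w ≠ 0) (hw0' : w' ≠ 0)
    (hind : ∀ k : F, w ≠ k • w')
    (h₁ : T.R w w' = 0) (h₂ : T.R w' w = 0)
    (hall : ∀ a, (∀ k : F, a ≠ k • T.one) → (∃ k : F, a = k • w) ∨ ∃ k : F, a = k • w') :
    T.LeftDistrib := by
  obtain ⟨a, b, hab⟩ := exists_eq_smul_add_smul hV hw0' hind T.one
  have ha : a • T.R w w = w := by
    have := T.apply_one w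
    rwa [hab, map_add, map_smul, map_smul, h₁, smul_zero, add_zero] at this
  have hb : b • T.R w' w' = w' := by
    have := T.apply_one w'
    rwa [hab, map_add, map_smul, map_smul, h₂, smul_zero, zero_add] at this
  have ha0 : a ≠ 0 := by rintro rfl; exact hw0 (by simpa using ha.symm)
  have hb0 : b ≠ 0 := by rintro rfl; exact hw0' (by simpa using hb.symm)
  have key : ∀ k : F, k ≠ 0 → k = a⁻¹ * b := by
    intro k hk
    by_cases hs : ∃ s : F, w + k • w' = s • T.one
    · obtain ⟨s, hs⟩ := hs
      have : (1 - s * a) • w + (k - s * b) • w' = 0 := by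
        linear_combination (norm := module) hs + s • hab
      obtain ⟨h3, h4⟩ := smul_add_smul_eq_zero hw0' hind this
      field_simp
      linear_combination a * h4 - b * h3
    · push Not at hs
      rcases hall _ hs with ⟨t, ht⟩ | ⟨t, ht⟩
      · have : (1 - t) • w + k • w' = 0 := by linear_combination (norm := module) ht
        exact absurd (smul_add_smul_eq_zero hw0' hind this).2 hk
      · have : (1 : F) • w + (k - t) • w' = 0 := by linear_combination (norm := module) ht
        exact absurd (smul_add_smul_eq_zero hw0' hind this).1 _root_.one_ne_zero
  have hF : ∀ k : F, k = 0 ∨ k = 1 := fun k => by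
    by_cases hk : k = 0
    · exact .inl hk
    · exact .inr ((key k hk).trans (key 1 _root_.one_ne_zero).symm)
  obtain rfl := (hF a).resolve_left ha0
  obtain rfl := (hF b).resolve_left hb0
  rw [one_smul, one_smul] at hab
  have hR : ∀ c d : F, T.R (c • w + d • w') = c • T.R w + d • T.R w' := by
    have h1 : T.R (w + w') = T.R w + T.R w' := by
      rw [← hab, T.map_one]
      refine LinearMap.ext fun x => ?_
      obtain ⟨c, d, rfl⟩ := exists_eq_smul_add_smul hV hw0' hind x
      rw [one_smul] at ha hb
      simp [h₁, h₂, ha, hb]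
    intro c d
    rcases hF c with rfl | rfl <;> rcases hF d with rfl | rfl <;> simp [T.map_zero, h1]
  intro x y
  obtain ⟨c, d, rfl⟩ := exists_eq_smul_add_smul hV hw0' hind x
  obtain ⟨c', d', rfl⟩ := exists_eq_smul_add_smul hV hw0' hind y
  rw [add_add_add_comm, ← add_smul, ← add_smul, hR, hR, hR]
  module

/-- If all nonscalars share one functional, `e` spans its kernel. Otherwise two of them annihilate
each other, every other one lies on one of their lines, and left distributivity follows. -/
theorem UnitsAreScalars.exists_isComplementVector_of_scalar (hU : T.UnitsAreScalars)
    (hV : finrank F V = 2) (hs : ∀ (k : F) x, T.R (k • T.one) x = k • x) {w₀ : V}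
    (hw₀ : ∀ k : F, w₀ ≠ k • T.one) (hd : ¬ T.LeftDistrib) : ∃ e, T.IsComplementVector e := by
  choose! l hl1 hl using fun w (hw : ∀ k : F, w ≠ k • T.one) => hU.exists_functional hV hw
  have hne : ∀ w, (∀ k : F, w ≠ k • T.one) → w ≠ 0 := fun w hw => by simpa using hw 0
  by_cases hall : ∀ w, (∀ k : F, w ≠ k • T.one) → l w = l w₀
  · have he : l w₀ (w₀ - l w₀ w₀ • T.one) = 0 := by
      refine (smul_eq_zero.1 ?_).resolve_right (hne _ hw₀)
      rw [← hl _ hw₀, map_sub, map_smul, T.apply_one, hl _ hw₀, sub_self]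
    refine ⟨w₀ - l w₀ w₀ • T.one, fun k hk => hw₀ (k + l w₀ w₀) ?_, fun k => ⟨k, hs _ _⟩,
      fun a ha => ?_⟩
    · rw [add_smul, ← hk, sub_add_cancel]
    · rw [hl a ha, hall a ha, he, zero_smul]
  push Not at hall
  obtain ⟨w, hw, hww⟩ := hall
  have hzero : ∀ {a b}, (∀ k : F, a ≠ k • T.one) → (∀ k : F, b ≠ k • T.one) → l a ≠ l b →
      T.R b a = 0 := fun {a b} ha hb hab => by
    rw [hl b hb]
    by_contra h
    exact hab (functional_eq_of_ne_zero hs (hne b hb) (hl a ha) (hl b hb)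
      fun h0 => h (by rw [h0, zero_smul]))
  have h₁ := hzero hw₀ hw hww.symm
  have h₂ := hzero hw hw₀ hww
  have hone : T.one ≠ 0 := T.one_ne_zero (hne w hw)
  have hker : ∀ {a b c}, (∀ k : F, a ≠ k • T.one) → (∀ k : F, b ≠ k • T.one) → T.R b a = 0 →
      T.R b c = 0 → ∃ k : F, c = k • a := fun {a b c} ha hb h h' => by
    obtain ⟨s, t, rfl⟩ := exists_eq_smul_add_smul hV hone ha c
    rw [map_add, map_smul, map_smul, h, T.apply_one, smul_zero, zero_add, smul_eq_zero] at h'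
    exact ⟨s, by rw [h'.resolve_right (hne b hb), zero_smul, add_zero]⟩
  refine absurd (leftDistrib_of_orthogonal hV (hne w hw) (hne _ hw₀) ?_ h₁ h₂ fun a ha => ?_) hd
  · rintro k rfl
    refine hww (funext fun x => smul_left_injective F (hne _ hw) ?_)
    change l (k • w₀) x • _ = l w₀ x • _
    rw [← hl _ hw, R_smul, LinearMap.comp_apply, hs, map_smul, hl _ hw₀, smul_comm]
  · by_cases h : l a = l w
    · exact .inl (hker hw hw₀ h₂ (hzero ha hw₀ (h ▸ hww)))
    · exact .inr (hker hw₀ hw h₁ (hzero ha hw h))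

/-- Injectivity is where fixed-point-freeness enters: `α k = 1` makes `e` a fixed point, so `k = 1`.
-/
theorem eigenvalue_properties (hT : T.FixedPointFree) {e : V} (he : e ≠ 0) {α : F → F}
    (hα : ∀ k : F, T.R (k • T.one) e = α k • e) :
    α 0 = 0 ∧ α 1 = 1 ∧ (∀ k l, α (k * l) = α k * α l) ∧ Function.Injective α := by
  have hinj := smul_left_injective F he
  have h0 : α 0 = 0 := hinj (by simp [← hα, T.map_zero])
  have h1 : α 1 = 1 := hinj (by simp [← hα, T.map_one])
  have hmul : ∀ k l, α (k * l) = α k * α l := fun k l => hinj <| by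
    change α (k * l) • e = (α k * α l) • e
    rw [← hα, ← R_smul_one_comp, LinearMap.comp_apply, hα, map_smul, hα, smul_smul, mul_comm]
  have hker : ∀ k, α k = 0 → k = 0 := fun k hk => by
    by_contra hk0
    have := hmul k k⁻¹
    rw [mul_inv_cancel₀ hk0, hk, h1, zero_mul] at this
    exact _root_.one_ne_zero this
  refine ⟨h0, h1, hmul, fun k l hkl => ?_⟩
  by_cases hl : l = 0
  · subst hl
    exact hker k (hkl.trans h0)
  by_cases hk : k = 0
  · subst hk
    exact (hker l (hkl.symm.trans h0)).symm
  have h : α (k * l⁻¹) = 1 := by rw [hmul, hkl, ← hmul, mul_inv_cancel₀ hl, h1]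
  have h' := hT _ (T.injective_R_smul_one (mul_ne_zero hk (inv_ne_zero hl))) e he
    (by rw [hα, h, one_smul])
  have h'' : k * l⁻¹ = 1 :=
    smul_left_injective F (T.one_ne_zero he) (by simpa using h')
  exact (mul_inv_eq_one₀ hl).1 h''

theorem UnitsAreScalars.exists_isComplementVector_of_not_scalar [Finite F]
    (hU : T.UnitsAreScalars) (hT : T.FixedPointFree) (hV : finrank F V = 2)
    (hs : ¬ ∀ (k : F) x, T.R (k • T.one) x = k • x) {w₀ : V}
    (hw₀ : ∀ k : F, w₀ ≠ k • T.one) : ∃ e, T.IsComplementVector e := by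
  have := Fintype.ofFinite F
  have hone : T.one ≠ 0 := T.one_ne_zero (w := w₀) (by simpa using hw₀ 0)
  push Not at hs
  obtain ⟨k₀, y, hy⟩ := hs
  obtain ⟨e, he⟩ : ∃ e, T.R (k₀ • T.one) y = k₀ • y + e := ⟨_, (add_sub_cancel _ _).symm⟩
  have he0 : e ≠ 0 := by rintro rfl; exact hy (by rw [he, add_zero])
  have heS : ∀ k : F, e ≠ k • T.one := by
    rintro s rfl
    -- A Jordan block: its power of exponent `Fintype.card F` loses the off-diagonal term, yet `k₀`
    -- to that power is `k₀`.
    have hpow : ∀ n : ℕ, T.R (k₀ ^ (n + 1) • T.one) y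
        = k₀ ^ (n + 1) • y + (((n + 1 : ℕ) : F) * k₀ ^ n * s) • T.one := by
      intro n
      induction n with
      | zero => simpa using he
      | succ n ih =>
        rw [pow_succ', ← R_smul_one_comp, LinearMap.comp_apply, ih, map_add, map_smul, map_smul,
          he, T.apply_one]
        push_cast
        module
    obtain ⟨n, hn⟩ : ∃ n, Fintype.card F = n + 1 :=
      Nat.exists_eq_succ_of_ne_zero Fintype.card_ne_zero
    have := hpow n
    rw [← hn, FiniteField.pow_card, FiniteField.cast_card_eq_zero, zero_mul, zero_mul,
      zero_smul, add_zero] at this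
    exact hy this
  have hyS : ∀ k : F, y ≠ k • T.one := by
    rintro s rfl
    rw [map_smul, T.apply_one, smul_comm] at hy
    exact hy rfl
  have heig : ∀ k : F, ∃ c : F, T.R (k • T.one) e = c • e := by
    intro k
    obtain ⟨a, b, hab⟩ := exists_eq_smul_add_smul hV hone hyS (T.R (k • T.one) y)
    refine ⟨a, ?_⟩
    -- Scalar translations commute; comparing both orders on `y` shows that `e` has eigenvalue `a`.
    have h1 : T.R (k₀ • T.one) (T.R (k • T.one) y) = T.R (k • T.one) (T.R (k₀ • T.one) y) := by
      rw [← LinearMap.comp_apply, ← LinearMap.comp_apply, R_smul_one_comp, R_smul_one_comp,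
        mul_comm]
    rw [he, map_add, map_smul, hab, map_add, map_smul, map_smul, he, T.apply_one] at h1
    linear_combination (norm := module) -h1
  refine ⟨e, heS, heig, fun w hw => ?_⟩
  choose α hα using heig
  obtain ⟨l, hl1, hl⟩ := hU.exists_functional hV hw
  obtain ⟨m, hm1, hm⟩ := hU.exists_functional hV heS
  by_contra hwe
  have ht : l e ≠ 0 := fun h => hwe (by rw [hl, h, zero_smul])
  obtain ⟨-, hα1, -, hinj⟩ := eigenvalue_properties hT he0 hα
  -- Two evaluations of `(e * (e * k)) * w`. As `α` is onto, this makes `α` linear, hence the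
  -- identity, against the choice of `y`.
  have key : ∀ k, α (α k * l e) = m e * α k := fun k => by
    have h : T.R w (T.R (k • T.one) e) = (α k * l e) • w := by
      rw [hα, map_smul, hl, smul_smul]
    have := R_apply_eq_of_eq_smul h e
    rw [T.map_apply, LinearMap.comp_apply, hm, map_smul, hα, hα, map_smul, map_smul, map_smul, hl,
      smul_smul, smul_smul, smul_smul] at this
    have := smul_left_injective F (by simpa using hw 0) this
    exact (mul_right_cancel₀ ht this).symm
  have hlin : ∀ c, α c = m e * (l e)⁻¹ * c := fun c => by
    obtain ⟨k, hk⟩ := Finite.surjective_of_injective hinj (c * (l e)⁻¹)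
    have := key k
    rw [hk, inv_mul_cancel_right₀ ht] at this
    rw [this]
    ring
  have hid : ∀ c, α c = c := fun c => by
    have h1 := hlin 1
    rw [hα1, mul_one] at h1
    rw [hlin, ← h1, one_mul]
  obtain ⟨a, b, rfl⟩ := exists_eq_smul_add_smul hV hone heS y
  refine hy ?_
  rw [map_add, map_smul, map_smul, hα, hid, T.apply_one]
  module

theorem UnitsAreScalars.exists_isComplementVector [Finite F] (hU : T.UnitsAreScalars)
    (hT : T.FixedPointFree) (hV : finrank F V = 2) {w₀ : V} (hw₀ : ∀ k : F, w₀ ≠ k • T.one)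
    (hd : ¬ T.LeftDistrib) : ∃ e, T.IsComplementVector e := by
  by_cases hs : ∀ (k : F) x, T.R (k • T.one) x = k • x
  · exact hU.exists_isComplementVector_of_scalar hV hs hw₀ hd
  · exact hU.exists_isComplementVector_of_not_scalar hT hV hs hw₀

end LinearTranslations

/-! ### From the near-ring to the plane -/

theorem nsmul_one_mul {N : Type*} [NearRingWithOne N] (n : ℕ) (a : N) :
    (n • (1 : N)) * a = n • a := by
  have := map_nsmul (rightTranslation a) n 1
  rwa [show rightTranslation a 1 = a from one_mul a] at this

/-- An f-near-ring of order `p ^ 2` has characteristic `p`. -/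
theorem IsFNearRing.nsmul_eq_zero {p : ℕ} {N : Type*} [NearRingWithOne N]
    (hcard : Nat.card N = p ^ 2) (hf : IsFNearRing N) (a : N) : p • a = 0 := by
  have hpp : p • p • (1 : N) = 0 := by rw [← mul_nsmul', ← sq, ← hcard]; exact card_nsmul_eq_zero'
  obtain ⟨z, hz⟩ : ∃ z : N, z = p • (1 : N) := ⟨_, rfl⟩
  have hzm : ∀ x : N, z * x = p • x := fun x => by rw [hz, nsmul_one_mul]
  have hzz : p • z = 0 := hz ▸ hpp
  have hcomm : ∀ n : ℤ, AddCommute (1 : N) (n • z) := fun n =>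
    .zsmul_right (hz ▸ .nsmul_right (.refl _) _) _
  have hadd : ∀ m n : ℤ, (1 + m • z) + n • z = 1 + (m + n) • z := fun m n => by
    rw [add_assoc, ← add_zsmul]
  have hmul : ∀ m : ℤ, z * (1 + m • z) = z := fun m => by
    rw [hzm, (hcomm m).add_nsmul, ← hz, ← natCast_zsmul, zsmul_comm, natCast_zsmul, hzz,
      zsmul_zero, add_zero]
  have hzmul : ∀ m n : ℤ, (1 + m • z) * (1 + n • z) = 1 + (m + n) • z := fun m n => by
    have h := map_zsmul (rightTranslation (1 + n • z)) m z
    rw [show rightTranslation (1 + n • z) z = z from hmul n] at h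
    have h' : (m • z) * (1 + n • z) = m • z := h
    rw [right_distrib', one_mul, h', hadd, add_comm]
  have hunit : ∀ m : ℤ, (1 + m • z) * (1 + (-m) • z) = 1 := fun m => by
    rw [hzmul, add_neg_cancel, zero_zsmul, add_zero]
  -- Since `p • z = 0`, the elements `1 + m • z` multiply by adding the `m`.
  let u : Nˣ := ⟨1 + (1 : ℤ) • z, 1 + (-1 : ℤ) • z, hunit 1, by simpa using hunit (-1)⟩
  have hz0 : z = 0 := by
    by_cases h : rightTranslation (u : N) = AddMonoidHom.id N
    · have h1 : (1 : N) * (1 + (1 : ℤ) • z) = 1 := DFunLike.congr_fun h 1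
      simpa using h1
    · exact hf.2 u h z (hmul 1)
  rw [← nsmul_one_mul, ← hz, hz0, (hf.1 a).1]

theorem add_comm_of_card_eq_prime_sq {p : ℕ} (hp : p.Prime) {G : Type*} [AddGroup G]
    (hcard : Nat.card G = p ^ 2) (a b : G) : a + b = b + a := by
  have : Fact p.Prime := ⟨hp⟩
  exact (IsPGroup.isMulCommutative_of_card_eq_prime_sq (G := Multiplicative G) (p := p)
    hcard).is_comm.comm (Multiplicative.ofAdd a) (Multiplicative.ofAdd b)

theorem isUnit_of_injective {N : Type*} [NearRingWithOne N] [Finite N] {u : N}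
    (hu : Function.Injective fun n : N => n * u) : IsUnit u := by
  obtain ⟨v, hv⟩ := Finite.surjective_of_injective hu 1
  have hv : v * u = 1 := hv
  exact ⟨⟨u, v, hu (by change u * v * u = 1 * u; rw [mul_assoc, hv, mul_one, one_mul]), hv⟩, rfl⟩

/-- The additive group of a near-ring with commutative addition. -/
abbrev addCommGroupOfComm {N : Type*} [NearRing N] (h : ∀ a b : N, a + b = b + a) :
    AddCommGroup N :=
  { (inferInstance : AddGroup N) with add_comm := h }

theorem IsFNearRing.exists_scalars {p : ℕ} [Fact p.Prime] {N : Type*} [NearRingWithOne N]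
    (hcard : Nat.card N = p ^ 2) (hf : IsFNearRing N) (hnf : ¬ IsNearField N) :
    ∃ s : ZMod p → N, Function.Injective s ∧ s 0 = 0 ∧ s 1 = 1 ∧
      (∀ a b, s (a + b) = s a + s b) ∧ (∀ a b, s (a * b) = s a * s b) ∧
      Set.range s = unitsWithZero N ∧
      (¬ IsRing N → ∃ (α : ZMod p → ZMod p) (g : ZMod p × ZMod p → N),
        α 0 = 0 ∧ (∀ a b, α (a * b) = α a * α b) ∧ Function.Injective α ∧
        Function.Bijective g ∧ (∀ x y, g (x + y) = g x + g y) ∧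
        (∀ x a, g x * g (0, a) = g (x.1 * α a, x.2 * a)) ∧
        ∀ x a, a.1 ≠ 0 → g x * g a = g (x.2 * a.1, x.2 * a.2)) := by
  have hp : p.Prime := Fact.out
  have : Finite N := Nat.finite_of_card_ne_zero (by rw [hcard]; exact pow_ne_zero _ hp.ne_zero)
  have hcomm := add_comm_of_card_eq_prime_sq hp hcard
  let _ : AddCommGroup N := addCommGroupOfComm hcomm
  obtain ⟨_⟩ : Nonempty (Module (ZMod p) N) :=
    ⟨AddCommGroup.zmodModule (hf.nsmul_eq_zero hcard)⟩
  let T : LinearTranslations (ZMod p) N :=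
    { R := fun b => (rightTranslation b).toZModLinearMap p
      one := 1
      map_zero := LinearMap.ext fun x => (hf.1 x).2
      map_one := LinearMap.ext fun x => mul_one x
      apply_one := fun b => one_mul b
      map_apply := fun a b => LinearMap.ext fun x => (mul_assoc x a b).symm }
  have hV : finrank (ZMod p) N = 2 := by
    have := Module.natCard_eq_pow_finrank (K := ZMod p) (V := N)
    rw [hcard, Nat.card_zmod] at this
    exact (Nat.pow_right_injective hp.two_le this).symm
  have hnontriv : (1 : N) ≠ 0 := fun h => by
    have hall : ∀ a : N, a = 0 := fun a => by rw [← one_mul a, h, (hf.1 a).1]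
    have : Subsingleton N := ⟨fun a b => (hall a).trans (hall b).symm⟩
    rw [Nat.card_of_subsingleton (0 : N)] at hcard
    exact hp.ne_one (Nat.pow_eq_one.1 hcard.symm |>.resolve_right two_ne_zero)
  have hinjU : ∀ u : N, Function.Injective (T.R u) → IsUnit u := fun u hu =>
    isUnit_of_injective (u := u) fun _ _ h => hu h
  have hT : T.FixedPointFree := by
    intro u hu x hx hxu
    by_contra hu1
    obtain ⟨v, rfl⟩ := hinjU u hu
    refine hx (hf.2 v (fun h => hu1 ?_) x hxu)
    have h1 : (1 : N) * (v : N) = 1 := DFunLike.congr_fun h 1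
    rwa [one_mul] at h1
  obtain ⟨w, hw0, hw⟩ : ∃ w : N, w ≠ 0 ∧ ¬ IsUnit w := by
    by_contra! h
    refine hnf ⟨1, hnontriv, fun a => ⟨one_mul a, mul_one a⟩, fun a ha => ?_⟩
    obtain ⟨u, rfl⟩ := h a ha
    exact ⟨_, u.mul_inv, u.inv_mul⟩
  have hwinj : ¬ Function.Injective (T.R w) := fun h => hw (hinjU w h)
  have hU : T.UnitsAreScalars := fun u => T.exists_eq_smul_one hV hT hw0 hwinj
  have hwS : ∀ k : ZMod p, w ≠ k • T.one := by
    rintro k rfl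
    refine hwinj (T.injective_R_smul_one ?_)
    rintro rfl
    exact hw0 (zero_smul _ _)
  have hsmul : ∀ (k : ZMod p) (x a : N), (k • x) * a = k • (x * a) := fun k x a =>
    map_smul (T.R a) k x
  have hinj : Function.Injective fun k : ZMod p => k • (1 : N) := smul_left_injective _ hnontriv
  refine ⟨fun k => k • (1 : N), hinj, zero_smul _ _, one_smul _ _,
    fun a b => add_smul _ _ _, fun a b => ?_, ?_, fun hring => ?_⟩
  · change (a * b) • (1 : N) = (a • (1 : N)) * (b • (1 : N))
    rw [hsmul, one_mul, mul_smul]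
  · ext n
    constructor
    · rintro ⟨k, rfl⟩
      by_cases hk : k = 0
      · exact .inr (by simp [hk])
      · exact .inl (hinjU _ (T.injective_R_smul_one hk))
    · rintro (⟨u, rfl⟩ | rfl)
      · obtain ⟨k, hk⟩ := hU (u : N) fun x y hxy => u.isUnit.mul_left_injective hxy
        exact ⟨k, hk.symm⟩
      · exact ⟨0, zero_smul _ _⟩
  have hd : ¬ T.LeftDistrib := fun h =>
    hring ⟨hcomm, fun a b c => DFunLike.congr_fun (h b c) a⟩
  obtain ⟨e, heS, heig, he⟩ := hU.exists_isComplementVector hT hV hwS hd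
  choose α hα using heig
  have he0 : e ≠ 0 := by simpa using heS 0
  obtain ⟨h0, -, hmul, hαinj⟩ := LinearTranslations.eigenvalue_properties hT he0 hα
  refine ⟨α, fun x => x.1 • e + x.2 • (1 : N), h0, hmul, hαinj, ⟨?_, ?_⟩, ?_, ?_, ?_⟩
  · rintro ⟨a, b⟩ ⟨c, d⟩ h
    have h : a • e + b • (1 : N) = c • e + d • (1 : N) := h
    have h' : (a - c) • e + (b - d) • (1 : N) = 0 := by linear_combination (norm := module) h
    obtain ⟨h1, h2⟩ := smul_add_smul_eq_zero hnontriv heS h'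
    rw [sub_eq_zero.1 h1, sub_eq_zero.1 h2]
  · intro x
    obtain ⟨a, b, rfl⟩ := exists_eq_smul_add_smul hV hnontriv heS x
    exact ⟨(a, b), rfl⟩
  · intro x y
    change (x.1 + y.1) • e + (x.2 + y.2) • (1 : N) = _
    module
  · rintro ⟨x, y⟩ a
    change T.R ((0 : ZMod p) • e + a • T.one) (x • e + y • T.one) = (x * α a) • e + (y * a) • T.one
    rw [zero_smul, zero_add, map_add, map_smul, map_smul, hα, T.apply_one, mul_smul, mul_smul]
  · rintro ⟨x, y⟩ ⟨a, b⟩ ha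
    change T.R (a • e + b • T.one) (x • e + y • T.one) = (y * a) • e + (y * b) • T.one
    have hS : ∀ k : ZMod p, a • e + b • T.one ≠ k • T.one := fun k h =>
      ha (smul_add_smul_eq_zero (a := a) (b := b - k) hnontriv heS
        (by change a • e + (b - k) • T.one = 0; linear_combination (norm := module) h)).1
    rw [map_add, map_smul, map_smul, he _ hS, T.apply_one]
    module

end NearRing

/-! ### Transport from `ZMod p` to `U₀` -/

open NearRing in
theorem mainTheorem5 (p : ℕ) (hp : p.Prime) (N : Type*) [NearRingWithOne N]
    (hcard : Nat.card N = p ^ 2) (hf : NearRing.IsFNearRing N)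
    (hnf : ¬ NearRing.IsNearField N) :
    NearRing.IsANearRing N ∧
      ∃ U₀ : NearRing.SubNearRing N,
        U₀.carrier = NearRing.unitsWithZero N ∧
        NearRing.IsCommField U₀.Elem ∧
        (¬ NearRing.IsRing N →
          ∃ α : U₀.Elem → U₀.Elem,
            NearRing.IsZeroPreservingMulAut α ∧
            Nonempty (N ≃+* NearRing.TwistedPower U₀.Elem 1 ![α, id])) := by
  have : Fact p.Prime := ⟨hp⟩
  obtain ⟨s, hinj, h0, h1, hadd, hmul, hrange, hform⟩ := hf.exists_scalars hcard hnf
  obtain ⟨U₀, hU₀⟩ : ∃ U₀ : SubNearRing N, U₀.carrier = Set.range s := ⟨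
    { carrier := Set.range s
      add_mem' := by rintro _ _ ⟨a, rfl⟩ ⟨b, rfl⟩; exact ⟨a + b, hadd a b⟩
      zero_mem' := ⟨0, h0⟩
      neg_mem' := by
        rintro _ ⟨a, rfl⟩
        exact ⟨-a, eq_neg_of_add_eq_zero_left (by rw [← hadd, neg_add_cancel, h0])⟩
      mul_mem' := by rintro _ _ ⟨a, rfl⟩ ⟨b, rfl⟩; exact ⟨a * b, hmul a b⟩ }, rfl⟩
  let ι : ZMod p ≃ U₀.Elem :=
    (Equiv.ofInjective s hinj).trans (Equiv.setCongr hU₀.symm)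
  have ι_zero : ι 0 = 0 := Subtype.ext h0
  have ι_add : ∀ a b, ι (a + b) = ι a + ι b := fun a b => Subtype.ext (hadd a b)
  have ι_mul : ∀ a b, ι (a * b) = ι a * ι b := fun a b => Subtype.ext (hmul a b)
  have ι_eq_zero : ∀ {a}, ι a = 0 ↔ a = 0 := fun {a} => by
    rw [← ι_zero, ι.injective.eq_iff]
  have hfield : IsCommField U₀.Elem := by
    refine ⟨⟨ι 1, fun h => one_ne_zero (ι_eq_zero.1 h), ι.surjective.forall.2 fun a => ?_,
      ι.surjective.forall.2 fun a ha => ⟨ι a⁻¹, ?_⟩⟩, ⟨ι.surjective.forall₂.2 fun a b => ?_,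
      ι.surjective.forall₃.2 fun a b c => ?_⟩, ι.surjective.forall₂.2 fun a b => ?_⟩
    · rw [← ι_mul, ← ι_mul, one_mul, mul_one]
      exact ⟨rfl, rfl⟩
    · have ha' : a ≠ 0 := fun h => ha (ι_eq_zero.2 h)
      rw [← ι_mul, ← ι_mul, mul_inv_cancel₀ ha', inv_mul_cancel₀ ha']
      exact ⟨rfl, rfl⟩
    · rw [← ι_add, ← ι_add, add_comm]
    · rw [← ι_add, ← ι_mul, ← ι_mul, ← ι_mul, ← ι_add, mul_add]
    · rw [← ι_mul, ← ι_mul, mul_comm]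
  refine ⟨⟨hf.1, U₀, hU₀.trans hrange, hfield.1⟩, U₀, hU₀.trans hrange, hfield, fun hring => ?_⟩
  obtain ⟨α, g, α_zero, α_mul, α_inj, hg, g_add, g_mul, g_mul'⟩ := hform hring
  let β : U₀.Elem → U₀.Elem := fun x => ι (α (ι.symm x))
  have β_ι : ∀ a, β (ι a) = ι (α a) := fun a => by simp [β]
  have β_bij : Function.Bijective β :=
    ι.bijective.comp ((Finite.injective_iff_bijective.1 α_inj).comp ι.symm.bijective)
  have β_zero : β 0 = 0 := by rw [← ι_zero, β_ι, α_zero]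
  refine ⟨β, ⟨β_zero, ⟨fun x hx h => hx (β_bij.1 (h.trans β_zero.symm)), β_bij.1.injOn,
    fun y hy => ?_⟩, ι.surjective.forall₂.2 fun a b _ _ => ?_⟩, ?_⟩
  · obtain ⟨x, rfl⟩ := β_bij.2 y
    exact ⟨x, fun hx => hy (by rw [hx, β_zero]), rfl⟩
  · rw [← ι_mul, β_ι, β_ι, β_ι, α_mul, ι_mul]
  -- The last coordinate is that of `1`, hence untwisted; the first is that of `e`.
  let φ : ZMod p × ZMod p ≃ TwistedPower U₀.Elem 1 ![β, id] :=
    (ι.prodCongr ι).trans (finTwoArrowEquiv U₀.Elem).symm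
  have φ_add : ∀ x y, φ (x + y) = φ x + φ y := fun x y => funext fun i => by
    fin_cases i
    · exact ι_add _ _
    · exact ι_add _ _
  have φ_mul : ∀ x a, φ x * φ (0, a) = φ (x.1 * α a, x.2 * a) := fun x a => by
    refine (if_pos fun i hi => ?_).trans (funext fun i => ?_)
    · fin_cases i
      · exact ι_zero
      · exact absurd rfl hi
    · fin_cases i
      · exact (congrArg (ι x.1 * ·) (β_ι a)).trans (ι_mul _ _).symm
      · exact (ι_mul _ _).symm
  have φ_mul' : ∀ x a, a.1 ≠ 0 → φ x * φ a = φ (x.2 * a.1, x.2 * a.2) := fun x a ha => by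
    refine (if_neg fun h => ha (ι_eq_zero.1 (h 0 (by decide)))).trans (funext fun i => ?_)
    fin_cases i
    · exact (ι_mul _ _).symm
    · exact (ι_mul _ _).symm
  let γ := Equiv.ofBijective g hg
  have hγ : ∀ x, γ x = g x := fun _ => rfl
  have hsymm : ∀ x, γ.symm (g x) = x := γ.symm_apply_apply
  refine ⟨{ γ.symm.trans φ with map_mul' := ?_, map_add' := ?_ }⟩
  · refine hg.2.forall₂.2 fun x a => ?_
    change φ (γ.symm (g x * g a)) = φ (γ.symm (g x)) * φ (γ.symm (g a))
    obtain ⟨a₁, a₂⟩ := a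
    by_cases ha : a₁ = 0
    · subst ha
      rw [g_mul, hsymm, hsymm, hsymm, φ_mul]
    · rw [g_mul' _ _ ha, hsymm, hsymm, hsymm, φ_mul' _ _ ha]
  · refine hg.2.forall₂.2 fun x a => ?_
    change φ (γ.symm (g x + g a)) = φ (γ.symm (g x)) + φ (γ.symm (g a))
    rw [← g_add, hsymm, hsymm, hsymm, φ_add]
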